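/- A finite abstract simplicial complex is a finite set $G$ of nonempty finite sets (faces) such that every nonempty subset of a face is a face; a face $x$ has dimension $\dim x=|x|-1$. The Cartesian product $G\times H$ has as cells all pairs $(x,y)$ with $x\in G$, $y\in H$; the dimension of $(x,y)$ is $\dim x+\dim y$, and two cells $(x,y)$, $(a,b)$ intersect if the sets $x\times y$ and $a\times b$ intersect. More generally, let $\mathcal G_0$ be the class of finite cell systems generated by the finite abstract simplicial complexes under disjoint union $\oplus$ (cells of different summands are disjoint) and the Cartesian product $\times$. For $G\in\mathcal G_0$ the connection matrix $L_G$ is indexed by the cells of $G$, with $L_G(x,y)=1$ if $x$ and $y$ intersect and $L_G(x,y)=0$ otherwise, and $\chi(G)=\sum_x(-1)^{\dim x}$, the sum being over all cells. The elements of the (Stanley–Reisner) ring generated by simplicial complexes are represented by formal differences $A\ominus B$ with $A,B\in\mathcal G_0$, multiplied by $(A\ominus B)\times(C\ominus D)=(A\times C\oplus B\times D)\ominus(A\times D\oplus B\times C)$; put $\chi(A\ominus B)=\chi(A)-\chi(B)$ and $L_{A\ominus B}=\begin{pmatrix}L_A&0\\0&-L_B\end{pmatrix}$. **Corollary.** Let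 $G$ and $H$ be finite abstract simplicial complexes or, more generally, elements of $\mathcal G_0$ or formal differences of elements of $\mathcal G_0$. Then the integer matrix $L_{G\times H}$ is invertible over $\mathbb Z$, and its inverse $g_{G\times H}=L_{G\times H}^{-1}$ satisfies $$\sum_{x,y} g_{G\times H}(x,y)=\chi(G\times H).$$ -/

import Mathlib

universe u

/-- A finite system of cells.  Every cell has a body (a set of points) and a dimension.  Finite
abstract simplicial complexes are of this kind, and, unlike simplicial complexes, such systems are
closed under the Cartesian product in which the cells are the pairs of cells. -/
structure CellComplex : Type (u + 1) where
  /-- the ambient set of points -/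
  Vertex : Type u
  /-- the index set of the cells -/
  Cell : Type u
  finite_cell : Finite Cell
  /-- the set of points of a cell -/
  body : Cell → Set Vertex
  /-- the dimension of a cell -/
  dim : Cell → ℕ

namespace CellComplex

noncomputable instance (G : CellComplex.{u}) : Fintype G.Cell :=
  haveI := G.finite_cell
  Fintype.ofFinite G.Cell

noncomputable instance (G : CellComplex.{u}) : DecidableEq G.Cell :=
  Classical.decEq G.Cell

/-- A finite abstract simplicial complex (a finite set of nonempty finite sets, closed under
passing to nonempty subsets): the cells are its faces `x`, with `dim x = |x| - 1`. -/
def ofComplex {V : Type u} (K : PreAbstractSimplicialComplex V) (hK : K.faces.Finite) :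
    CellComplex.{u} where
  Vertex := V
  Cell := K.faces
  finite_cell := hK.to_subtype
  body x := (x.1 : Set V)
  dim x := x.1.card - 1

/-- Disjoint union: cells of different summands have disjoint bodies. -/
def disjUnion (G H : CellComplex.{u}) : CellComplex.{u} where
  Vertex := G.Vertex ⊕ H.Vertex
  Cell := G.Cell ⊕ H.Cell
  finite_cell :=
    haveI := G.finite_cell
    haveI := H.finite_cell
    inferInstance
  body := Sum.elim (fun x => Sum.inl '' G.body x) (fun y => Sum.inr '' H.body y)
  dim := Sum.elim G.dim H.dim

/-- Cartesian product: the cells are all the pairs `(x, y)`, with body `x × y` and with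
dimension `dim x + dim y`. -/
def prod (G H : CellComplex.{u}) : CellComplex.{u} where
  Vertex := G.Vertex × H.Vertex
  Cell := G.Cell × H.Cell
  finite_cell :=
    haveI := G.finite_cell
    haveI := H.finite_cell
    inferInstance
  body X := G.body X.1 ×ˢ H.body X.2
  dim X := G.dim X.1 + H.dim X.2

/-- The cell systems generated by the finite abstract simplicial complexes with the
disjoint union as addition and the Cartesian product as multiplication. -/
inductive IsGenerated : CellComplex.{u} → Prop
  | ofComplex {V : Type u} (K : PreAbstractSimplicialComplex V) (hK : K.faces.Finite) :
      IsGenerated (ofComplex K hK)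
  | disjUnion {G H : CellComplex.{u}} :
      IsGenerated G → IsGenerated H → IsGenerated (G.disjUnion H)
  | prod {G H : CellComplex.{u}} :
      IsGenerated G → IsGenerated H → IsGenerated (G.prod H)

open Classical in
/-- The connection matrix: `L x y = 1` if the cells `x` and `y` intersect, else `L x y = 0`. -/
noncomputable def connectionMatrix (G : CellComplex.{u}) : Matrix G.Cell G.Cell ℤ :=
  fun x y => if (G.body x ∩ G.body y).Nonempty then 1 else 0

/-- The Euler characteristic: the sum of `(-1) ^ dim x` over all cells `x`. -/
noncomputable def eulerChar (G : CellComplex.{u}) : ℤ :=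
  ∑ x : G.Cell, (-1) ^ G.dim x

end CellComplex

/-- A formal difference `pos ⊖ neg` of two cell systems. -/
structure SignedComplex : Type (u + 1) where
  pos : CellComplex.{u}
  neg : CellComplex.{u}

namespace SignedComplex

/-- The elements of the Stanley-Reisner ring are represented by the formal differences of two cell
systems that are generated by finite abstract simplicial complexes. -/
def IsGenerated (G : SignedComplex.{u}) : Prop :=
  G.pos.IsGenerated ∧ G.neg.IsGenerated

/-- `(A ⊖ B) × (C ⊖ D) = (A × C ⊕ B × D) ⊖ (A × D ⊕ B × C)`. -/
def prod (G H : SignedComplex.{u}) : SignedComplex.{u} where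
  pos := (G.pos.prod H.pos).disjUnion (G.neg.prod H.neg)
  neg := (G.pos.prod H.neg).disjUnion (G.neg.prod H.pos)

/-- `L (A ⊖ B)` is the block diagonal matrix with the blocks `L A` and `- L B`. -/
noncomputable def connectionMatrix (G : SignedComplex.{u}) :
    Matrix (G.pos.Cell ⊕ G.neg.Cell) (G.pos.Cell ⊕ G.neg.Cell) ℤ :=
  Matrix.fromBlocks G.pos.connectionMatrix 0 0 (-G.neg.connectionMatrix)

/-- `χ (A ⊖ B) = χ A - χ B`. -/
noncomputable def eulerChar (G : SignedComplex.{u}) : ℤ :=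
  G.pos.eulerChar - G.neg.eulerChar

end SignedComplex

namespace CellComplex

/-! For a simplicial complex, let `Z` be the incidence matrix of inclusion and `D` the diagonal
matrix of the signs `(-1) ^ dim`. The signed count of the nonempty subsets of `x ∩ y` is `1` or `0`
according as `x` and `y` meet, so `L = Zᵀ D Z` (`connectionMatrix_ofComplex`). As `Z` is
unitriangular and `D * D = 1`, the inverse is `Z⁻¹ D Z⁻ᵀ`. The same count on one face gives `Zᵀ sign
= 1`, so the entries of the inverse sum to `signᵀ D sign = ∑ sign ^ 3 = χ`. Products give Kronecker
products and disjoint unions give block sums; inverses and entry sums follow, and induction on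
`IsGenerated` concludes. -/

/-- The matrix `g` is an inverse of the connection matrix, and its total energy is the Euler
characteristic. -/
structure IsGreenFunction (G : CellComplex.{u}) (g : Matrix G.Cell G.Cell ℤ) : Prop where
  mul_eq_one : G.connectionMatrix * g = 1
  sum_eq : ∑ x, ∑ y, g x y = G.eulerChar

theorem IsGreenFunction.isUnit_det {G : CellComplex.{u}} {g : Matrix G.Cell G.Cell ℤ}
    (h : G.IsGreenFunction g) : IsUnit G.connectionMatrix.det :=
  Matrix.isUnit_det_of_right_inverse h.mul_eq_one

theorem IsGreenFunction.inv_eq {G : CellComplex.{u}} {g : Matrix G.Cell G.Cell ℤ}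
    (h : G.IsGreenFunction g) : G.connectionMatrix⁻¹ = g :=
  Matrix.inv_eq_right_inv h.mul_eq_one

/-- Needed even for identity equivalences: the `Fintype` and `DecidableEq` instances on `Cell` are
chosen classically and need not be the structural ones on a product or sum type. -/
theorem IsGreenFunction.of_submatrix {G : CellComplex.{u}} {n : Type*} [Fintype n] [DecidableEq n]
    (e : G.Cell ≃ n) {A B : Matrix n n ℤ} (hA : G.connectionMatrix = A.submatrix e e)
    (hAB : A * B = 1) (hB : ∑ x, ∑ y, B x y = G.eulerChar) :
    G.IsGreenFunction (B.submatrix e e) := by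
  constructor
  · rw [hA, Matrix.submatrix_mul_equiv, hAB, Matrix.submatrix_one_equiv]
  · rw [← hB, ← Equiv.sum_comp e]
    refine Finset.sum_congr rfl fun x _ => ?_
    rw [← Equiv.sum_comp e]
    rfl

/-! ### Products and disjoint unions -/

/-- The cells of a product are the pairs of cells. -/
def prodCellEquiv (G H : CellComplex.{u}) : (G.prod H).Cell ≃ G.Cell × H.Cell :=
  Equiv.refl _

/-- The cells of a disjoint union are the cells of the summands. -/
def disjUnionCellEquiv (G H : CellComplex.{u}) : (G.disjUnion H).Cell ≃ G.Cell ⊕ H.Cell :=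
  Equiv.refl _

theorem eulerChar_prod (G H : CellComplex.{u}) :
    (G.prod H).eulerChar = G.eulerChar * H.eulerChar := by
  rw [eulerChar, ← Equiv.sum_comp (prodCellEquiv G H).symm, Fintype.sum_prod_type, eulerChar,
    eulerChar, Finset.sum_mul_sum]
  exact Finset.sum_congr rfl fun a _ => Finset.sum_congr rfl fun b _ => pow_add _ _ _

theorem eulerChar_disjUnion (G H : CellComplex.{u}) :
    (G.disjUnion H).eulerChar = G.eulerChar + H.eulerChar := by
  rw [eulerChar, ← Equiv.sum_comp (disjUnionCellEquiv G H).symm, Fintype.sum_sum_type]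
  rfl

theorem connectionMatrix_prod (G H : CellComplex.{u}) :
    (G.prod H).connectionMatrix =
      (Matrix.kroneckerMap (· * ·) G.connectionMatrix H.connectionMatrix).submatrix
        (prodCellEquiv G H) (prodCellEquiv G H) := by
  classical
  ext ⟨a, b⟩ ⟨c, d⟩
  have h : (G.body a ×ˢ H.body b ∩ G.body c ×ˢ H.body d).Nonempty ↔
      (G.body a ∩ G.body c).Nonempty ∧ (H.body b ∩ H.body d).Nonempty := by
    rw [Set.prod_inter_prod, Set.prod_nonempty_iff]
  change ite (G.body a ×ˢ H.body b ∩ G.body c ×ˢ H.body d).Nonempty (1 : ℤ) 0 =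
    ite (G.body a ∩ G.body c).Nonempty 1 0 * ite (H.body b ∩ H.body d).Nonempty 1 0
  simp only [h]
  split_ifs <;> simp_all

theorem connectionMatrix_disjUnion (G H : CellComplex.{u}) :
    (G.disjUnion H).connectionMatrix =
      (Matrix.fromBlocks G.connectionMatrix 0 0 H.connectionMatrix).submatrix
        (disjUnionCellEquiv G H) (disjUnionCellEquiv G H) := by
  classical
  ext (a | a) (b | b)
  · have h : (Sum.inl '' G.body a ∩ Sum.inl '' G.body b : Set (G.Vertex ⊕ H.Vertex)).Nonempty ↔
        (G.body a ∩ G.body b).Nonempty := by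
      rw [← Set.image_inter Sum.inl_injective, Set.image_nonempty]
    change ite (Sum.inl '' G.body a ∩ Sum.inl '' G.body b : Set (G.Vertex ⊕ H.Vertex)).Nonempty
      (1 : ℤ) 0 = ite (G.body a ∩ G.body b).Nonempty 1 0
    simp only [h]
  · refine if_neg ?_
    rintro ⟨_, ⟨x, _, rfl⟩, y, _, h⟩
    exact Sum.inr_ne_inl h
  · refine if_neg ?_
    rintro ⟨_, ⟨x, _, rfl⟩, y, _, h⟩
    exact Sum.inl_ne_inr h
  · have h : (Sum.inr '' H.body a ∩ Sum.inr '' H.body b : Set (G.Vertex ⊕ H.Vertex)).Nonempty ↔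
        (H.body a ∩ H.body b).Nonempty := by
      rw [← Set.image_inter Sum.inr_injective, Set.image_nonempty]
    change ite (Sum.inr '' H.body a ∩ Sum.inr '' H.body b : Set (G.Vertex ⊕ H.Vertex)).Nonempty
      (1 : ℤ) 0 = ite (H.body a ∩ H.body b).Nonempty 1 0
    simp only [h]

theorem IsGreenFunction.prod {G H : CellComplex.{u}} {g : Matrix G.Cell G.Cell ℤ}
    {h : Matrix H.Cell H.Cell ℤ} (hg : G.IsGreenFunction g) (hh : H.IsGreenFunction h) :
    (G.prod H).IsGreenFunction
      ((Matrix.kroneckerMap (· * ·) g h).submatrix (prodCellEquiv G H)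
        (prodCellEquiv G H)) := by
  refine .of_submatrix _ (connectionMatrix_prod G H) ?_ ?_
  · rw [← Matrix.mul_kronecker_mul, hg.mul_eq_one, hh.mul_eq_one, Matrix.one_kronecker_one]
  · rw [eulerChar_prod, ← hg.sum_eq, ← hh.sum_eq]
    simp only [Fintype.sum_prod_type, Finset.sum_mul_sum, Matrix.kroneckerMap_apply]

theorem IsGreenFunction.disjUnion {G H : CellComplex.{u}} {g : Matrix G.Cell G.Cell ℤ}
    {h : Matrix H.Cell H.Cell ℤ} (hg : G.IsGreenFunction g) (hh : H.IsGreenFunction h) :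
    (G.disjUnion H).IsGreenFunction
      ((Matrix.fromBlocks g 0 0 h).submatrix (disjUnionCellEquiv G H)
        (disjUnionCellEquiv G H)) := by
  refine .of_submatrix _ (connectionMatrix_disjUnion G H) ?_ ?_
  · simp [Matrix.fromBlocks_multiply, hg.mul_eq_one, hh.mul_eq_one]
  · rw [eulerChar_disjUnion, ← hg.sum_eq, ← hh.sum_eq]
    simp [Fintype.sum_sum_type]

/-! ### Simplicial complexes -/

section Simplicial

variable {V : Type u} (K : PreAbstractSimplicialComplex V) (hK : K.faces.Finite)

open Classical in
/-- The incidence matrix of the inclusion relation between faces. -/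
noncomputable def faceZeta : Matrix (ofComplex K hK).Cell (ofComplex K hK).Cell ℤ :=
  fun z x => if z.1 ⊆ x.1 then 1 else 0

/-- The sign `(-1) ^ dim x` of a face. -/
noncomputable def faceSign (x : (ofComplex K hK).Cell) : ℤ :=
  (-1) ^ (ofComplex K hK).dim x

theorem faceSign_mul_self (x : (ofComplex K hK).Cell) :
    faceSign K hK x * faceSign K hK x = 1 := by
  rw [faceSign, ← mul_pow]
  simp

theorem sum_nonempty_subsets_neg_one_pow (s : Finset V) :
    ∑ z ∈ s.powerset with z.Nonempty, (-1 : ℤ) ^ (z.card - 1) = if s.Nonempty then 1 else 0 := by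
  classical
  have h := Finset.sum_powerset_neg_one_pow_card (x := s)
  have h1 : s.powerset.filter (fun z => z.Nonempty) = s.powerset.erase ∅ := by
    ext z
    simp [Finset.nonempty_iff_ne_empty, and_comm]
  -- Away from `∅` the subtraction `z.card - 1` does not truncate, so each sign flips.
  have h2 : ∑ z ∈ s.powerset.erase ∅, (-1 : ℤ) ^ (z.card - 1) =
      -∑ z ∈ s.powerset.erase ∅, (-1 : ℤ) ^ z.card := by
    rw [← Finset.sum_neg_distrib]
    refine Finset.sum_congr rfl fun z hz => ?_
    have hz' : 0 < z.card := by
      simp only [Finset.mem_erase] at hz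
      exact Finset.card_pos.2 (Finset.nonempty_iff_ne_empty.2 hz.1)
    obtain ⟨n, hn⟩ := Nat.exists_eq_succ_of_ne_zero hz'.ne'
    simp [hn, pow_succ]
  rw [← Finset.add_sum_erase _ _ (Finset.empty_mem_powerset s)] at h
  rw [h1, h2]
  simp only [Finset.nonempty_iff_ne_empty, ne_eq, ite_not]
  simp only [Finset.card_empty, pow_zero] at h
  split_ifs at h ⊢ <;> linarith

open Classical in
/-- The signed count of the faces inside a set of vertices of a face. -/
theorem sum_faceSign_subset (x : (ofComplex K hK).Cell) (s : Finset V) (hs : s ⊆ x.1) :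
    ∑ z : (ofComplex K hK).Cell, (if z.1 ⊆ s then faceSign K hK z else 0) =
      if s.Nonempty then 1 else 0 := by
  rw [← sum_nonempty_subsets_neg_one_pow, ← Finset.sum_filter]
  refine Finset.sum_bij (fun z _ => z.1) ?_ ?_ ?_ ?_
  · intro z hz
    simp only [Finset.mem_filter, Finset.mem_univ, true_and, Finset.mem_powerset] at hz ⊢
    exact ⟨hz, (K.isRelLowerSet_faces z.2).1⟩
  · exact fun a _ b _ h => Subtype.ext h
  · intro z hz
    simp only [Finset.mem_filter, Finset.mem_powerset] at hz
    -- Since `s` lies in the face `x`, each of its nonempty subsets is a face.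
    exact ⟨⟨z, (K.isRelLowerSet_faces x.2).2 (hz.1.trans hs) hz.2⟩, Finset.mem_filter.2 ⟨Finset.mem_univ _, hz.1⟩, rfl⟩
  · exact fun _ _ => rfl

theorem faceZeta_transpose_mulVec_faceSign :
    Matrix.mulVec (faceZeta K hK).transpose (faceSign K hK) = 1 := by
  classical
  ext x
  have h := sum_faceSign_subset K hK x x.1 subset_rfl
  rw [if_pos ((K.isRelLowerSet_faces x.2).1)] at h
  simpa [Matrix.mulVec, dotProduct, faceZeta] using h

/-- The `(x, y)` entry on the right is the signed count of faces contained in both `x` and `y`, that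
is, in `x ∩ y`. -/
theorem connectionMatrix_ofComplex :
    (ofComplex K hK).connectionMatrix =
      (faceZeta K hK).transpose * Matrix.diagonal (faceSign K hK) * faceZeta K hK := by
  classical
  ext x y
  have h := sum_faceSign_subset K hK x (x.1 ∩ y.1) Finset.inter_subset_left
  have hb : ((ofComplex K hK).body x ∩ (ofComplex K hK).body y).Nonempty ↔
      (x.1 ∩ y.1).Nonempty := by
    change ((x.1 : Set V) ∩ (y.1 : Set V)).Nonempty ↔ _
    rw [← Finset.coe_inter, Finset.coe_nonempty]
  simp only [connectionMatrix, hb]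
  rw [Matrix.mul_apply]
  simp only [Matrix.mul_diagonal, Matrix.transpose_apply, faceZeta]
  rw [← h]
  refine Finset.sum_congr rfl fun z _ => ?_
  simp only [Finset.subset_inter_iff]
  split_ifs <;> simp_all

/-- Grading by cardinality makes the matrix block triangular; nested faces of equal size coincide,
so the diagonal blocks are identities. -/
theorem det_faceZeta : (faceZeta K hK).det = 1 := by
  classical
  have ht : (faceZeta K hK).BlockTriangular (fun x => x.1.card) := fun x y hxy =>
    if_neg fun h => (Finset.card_le_card h).not_gt hxy
  rw [ht.det]
  refine Finset.prod_eq_one fun n _ => ?_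
  have h1 : (faceZeta K hK).toSquareBlock (fun x => x.1.card) n = 1 := by
    ext ⟨x, hx⟩ ⟨y, hy⟩
    have hs : x.1 ⊆ y.1 ↔ x = y :=
      ⟨fun h => Subtype.ext (Finset.eq_of_subset_of_card_le h (hy.trans hx.symm).le),
        fun h => h ▸ subset_rfl⟩
    simp [Matrix.toSquareBlock_def, faceZeta, Matrix.one_apply, hs]
  rw [h1, Matrix.det_one]

theorem exists_isGreenFunction_ofComplex : ∃ g, (ofComplex K hK).IsGreenFunction g := by
  set Z := faceZeta K hK with hZ
  set D := Matrix.diagonal (faceSign K hK) with hD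
  have hu : IsUnit Z.det := by simp [hZ, det_faceZeta]
  have hut : IsUnit Z.transpose.det := by rwa [Matrix.det_transpose]
  have hDD : D * D = 1 := by
    simp [hD, Matrix.diagonal_mul_diagonal, faceSign_mul_self]
  have hv : Matrix.mulVec (Z.transpose)⁻¹ 1 = faceSign K hK := by
    rw [← faceZeta_transpose_mulVec_faceSign K hK, Matrix.mulVec_mulVec,
      Matrix.nonsing_inv_mul _ hut, Matrix.one_mulVec]
  have hv' : Matrix.vecMul 1 Z⁻¹ = faceSign K hK := by
    rw [← hv, ← Matrix.transpose_nonsing_inv, Matrix.mulVec_transpose]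
  refine ⟨Z⁻¹ * D * (Z.transpose)⁻¹, ?_, ?_⟩
  · rw [connectionMatrix_ofComplex]
    calc Z.transpose * D * Z * (Z⁻¹ * D * (Z.transpose)⁻¹)
        = Z.transpose * D * (Z * Z⁻¹) * D * (Z.transpose)⁻¹ := by
          simp only [Matrix.mul_assoc]
      _ = Z.transpose * (D * D) * (Z.transpose)⁻¹ := by
          rw [Matrix.mul_nonsing_inv _ hu, Matrix.mul_one, Matrix.mul_assoc Z.transpose]
      _ = 1 := by rw [hDD, Matrix.mul_one, Matrix.mul_nonsing_inv _ hut]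
  · have hs : ∑ x, ∑ y, (Z⁻¹ * D * (Z.transpose)⁻¹) x y =
        1 ⬝ᵥ Matrix.mulVec (Z⁻¹ * D * (Z.transpose)⁻¹) 1 := by
      simp [dotProduct, Matrix.mulVec]
    -- Both outer factors turn the all-ones vector into the sign vector, leaving `signᵀ D sign`.
    rw [hs, ← Matrix.mulVec_mulVec, hv, ← Matrix.mulVec_mulVec, Matrix.dotProduct_mulVec, hv']
    simp only [dotProduct, hD, Matrix.mulVec_diagonal, faceSign_mul_self, mul_one]
    rfl

end Simplicial

/-! ### Generated systems and formal differences -/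

theorem IsGenerated.exists_isGreenFunction {G : CellComplex.{u}} (hG : G.IsGenerated) :
    ∃ g, G.IsGreenFunction g := by
  induction hG with
  | ofComplex K hK => exact exists_isGreenFunction_ofComplex K hK
  | disjUnion _ _ ihG ihH =>
    obtain ⟨g, hg⟩ := ihG
    obtain ⟨h, hh⟩ := ihH
    exact ⟨_, hg.disjUnion hh⟩
  | prod _ _ ihG ihH =>
    obtain ⟨g, hg⟩ := ihG
    obtain ⟨h, hh⟩ := ihH
    exact ⟨_, hg.prod hh⟩

theorem IsGenerated.isUnit_det_and_sum_inv {G : CellComplex.{u}} (hG : G.IsGenerated) :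
    IsUnit G.connectionMatrix.det ∧ ∑ x, ∑ y, (G.connectionMatrix⁻¹) x y = G.eulerChar := by
  obtain ⟨g, hg⟩ := hG.exists_isGreenFunction
  exact ⟨hg.isUnit_det, by rw [hg.inv_eq, hg.sum_eq]⟩

end CellComplex

namespace SignedComplex

theorem IsGenerated.prod {G H : SignedComplex.{u}} (hG : G.IsGenerated) (hH : H.IsGenerated) :
    (G.prod H).IsGenerated :=
  ⟨(hG.1.prod hH.1).disjUnion (hG.2.prod hH.2), (hG.1.prod hH.2).disjUnion (hG.2.prod hH.1)⟩

theorem IsGenerated.isUnit_det_and_sum_inv {G : SignedComplex.{u}} (hG : G.IsGenerated) :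
    IsUnit G.connectionMatrix.det ∧ ∑ x, ∑ y, (G.connectionMatrix⁻¹) x y = G.eulerChar := by
  obtain ⟨g, hg⟩ := hG.1.exists_isGreenFunction
  obtain ⟨h, hh⟩ := hG.2.exists_isGreenFunction
  have key : G.connectionMatrix * Matrix.fromBlocks g 0 0 (-h) = 1 := by
    simp [connectionMatrix, Matrix.fromBlocks_multiply, hg.mul_eq_one, hh.mul_eq_one]
  refine ⟨Matrix.isUnit_det_of_right_inverse key, ?_⟩
  rw [Matrix.inv_eq_right_inv key, eulerChar, ← hg.sum_eq, ← hh.sum_eq]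
  simp [Fintype.sum_sum_type, sub_eq_add_neg]

end SignedComplex

theorem mainTheorem10 :
    (∀ (V W : Type u) (K : PreAbstractSimplicialComplex V) (M : PreAbstractSimplicialComplex W)
      (hK : K.faces.Finite) (hM : M.faces.Finite),
      IsUnit ((CellComplex.ofComplex K hK).prod
          (CellComplex.ofComplex M hM)).connectionMatrix.det ∧
        ∑ x, ∑ y, (((CellComplex.ofComplex K hK).prod
            (CellComplex.ofComplex M hM)).connectionMatrix⁻¹) x y =
          ((CellComplex.ofComplex K hK).prod (CellComplex.ofComplex M hM)).eulerChar) ∧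
    (∀ G H : CellComplex.{u}, G.IsGenerated → H.IsGenerated →
      IsUnit (G.prod H).connectionMatrix.det ∧
        ∑ x, ∑ y, ((G.prod H).connectionMatrix⁻¹) x y = (G.prod H).eulerChar) ∧
    (∀ G H : SignedComplex.{u}, G.IsGenerated → H.IsGenerated →
      IsUnit (G.prod H).connectionMatrix.det ∧
        ∑ x, ∑ y, ((G.prod H).connectionMatrix⁻¹) x y = (G.prod H).eulerChar) :=
  ⟨fun _ _ K M hK hM => ((CellComplex.IsGenerated.ofComplex K hK).prod
      (CellComplex.IsGenerated.ofComplex M hM)).isUnit_det_and_sum_inv,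
    fun _ _ hG hH => (hG.prod hH).isUnit_det_and_sum_inv,
    fun _ _ hG hH => (hG.prod hH).isUnit_det_and_sum_inv⟩
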